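/- \textbf{Setting.} Let $d\ge 1$. A state is a positive semidefinite matrix $\rho\in\mathbb{C}^{d\times d}$ with $\operatorname{Tr}\rho=1$; the trace distance is $\|\rho-\sigma\|_{\mathrm{Tr}}=\tfrac12\|\rho-\sigma\|_1$, half the sum of the singular values of $\rho-\sigma$. A (finite) POVM is a family $(M_x)_{x\in\mathcal X}$ of positive semidefinite $d\times d$ matrices, indexed by a finite set $\mathcal X$, with $\sum_x M_x=I$; measuring $\rho$ yields $x$ with probability $\operatorname{Tr}(\rho M_x)$. A non-adaptive single-copy tomography algorithm on $n$ copies consists of POVMs $\mathcal M_1,\dots,\mathcal M_n$ with a common outcome set $\mathcal X$, fixed in advance, and a map $\hat\rho$ from $\mathcal X^n$ to states. Under $\gamma$-adversarial corruption, copy $i$ of the unknown state $\rho$ is measured with $\mathcal M_i$, independently for $i=1,\dots,n$, giving $x=(x_1,\dots,x_n)$; an adversary, who knows $\rho$, the algorithm and all of $x$, replaces $x$ by some $y=A(x)\in\mathcal X^n$ with $|\{i: y_i\ne x_i\}|\le\gamma n$; the algorithm outputs $\hat\rho(y)$. \textbf{Theorem.} There are universal constants $C_1,C_2>0$ such that the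 following holds for all integers $1\le r\le d$, all $\gamma,\delta\in(0,1)$, and every integer \[ n\ \ge\ C_2\,\frac{d\,r\,\log(2r/\gamma)+\log(1/\delta)}{\gamma^2}. \] There is a non-adaptive single-copy tomography algorithm on $n$ copies, depending only on $d,r,\gamma,\delta,n$, such that for every state $\rho$ of rank at most $r$ and every adversary as above, with probability at least $1-\delta$, \[ \|\hat\rho(y)-\rho\|_{\mathrm{Tr}}\ \le\ C_1\,\gamma\sqrt r . \] In particular, with $\varepsilon=C_1\gamma\sqrt r$ and constant $\delta$, $n=\tilde O(dr/\gamma^2)=\tilde O(dr^2/\varepsilon^2)$ copies suffice for trace-distance error $\varepsilon$. -/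

import Mathlib

open scoped ComplexOrder

/-- A quantum state of a `d`-dimensional system: a positive semidefinite matrix of trace one. -/
structure QState (d : ℕ) where
  mat : Matrix (Fin d) (Fin d) ℂ
  posSemidef : mat.PosSemidef
  trace_eq_one : mat.trace = 1

/-- The trace distance `‖ρ - σ‖₁ / 2`. The singular values of the Hermitian matrix `ρ - σ` are the
absolute values of its eigenvalues. -/
noncomputable def QState.traceDist {d : ℕ} (ρ σ : QState d) : ℝ :=
  (1 / 2) * ∑ i, |(ρ.posSemidef.isHermitian.sub σ.posSemidef.isHermitian).eigenvalues i|

/-- A positive operator-valued measure on `ℂ^d` with outcome set `X`. -/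
structure POVM (d : ℕ) (X : Type) [Fintype X] where
  effect : X → Matrix (Fin d) (Fin d) ℂ
  posSemidef : ∀ x, (effect x).PosSemidef
  sum_eq_one : ∑ x, effect x = 1

/-- Born's rule: the probability of the outcome `x` when `ρ` is measured with `M`. -/
noncomputable def POVM.prob {d : ℕ} {X : Type} [Fintype X] (M : POVM d X) (ρ : QState d)
    (x : X) : ℝ :=
  ((ρ.mat * M.effect x).trace).re

/-- A non-adaptive single-copy tomography algorithm on `n` copies: a measurement of each copy,
fixed in advance, and a state computed from the `n` (possibly corrupted) outcomes. -/
structure TomographyAlgorithm (d n : ℕ) where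
  Outcome : Type
  [fintypeOutcome : Fintype Outcome]
  povm : Fin n → POVM d Outcome
  estimate : (Fin n → Outcome) → QState d

attribute [instance] TomographyAlgorithm.fintypeOutcome

open Classical in
/-- An adversary that sees all the outcomes and changes at most a `γ`-fraction of them. -/
def IsAdversary {n : ℕ} {X : Type} (γ : ℝ) (A : (Fin n → X) → (Fin n → X)) : Prop :=
  ∀ x, ((Finset.univ.filter fun i => A x i ≠ x i).card : ℝ) ≤ γ * n

open Classical in
/-- The probability, over the outcomes `x` of measuring `n` independent copies of `ρ`, that the
estimate computed from the corrupted outcomes `A x` is within trace distance `ε` of `ρ`. -/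
noncomputable def TomographyAlgorithm.successProb {d n : ℕ} (T : TomographyAlgorithm d n)
    (ρ : QState d) (A : (Fin n → T.Outcome) → (Fin n → T.Outcome)) (ε : ℝ) : ℝ :=
  ∑ x ∈ Finset.univ.filter (fun x => (T.estimate (A x)).traceDist ρ ≤ ε),
    ∏ i, (T.povm i).prob ρ (x i)

/-- Robustness: for every unknown state of rank at most `r` and every adversary, who may know the
state and the whole algorithm, the estimate has trace-distance error at most `ε` with probability
at least `1 - δ`. -/
def TomographyAlgorithm.Learns {d n : ℕ} (T : TomographyAlgorithm d n) (r : ℕ)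
    (γ ε δ : ℝ) : Prop :=
  ∀ ρ : QState d, ρ.mat.rank ≤ r →
    ∀ A : (Fin n → T.Outcome) → (Fin n → T.Outcome), IsAdversary γ A →
      1 - δ ≤ T.successProb ρ A ε

/-! Every copy is measured with the same POVM, chosen so that the `ℓ¹` distance between the outcome
distributions of any two states is at least 1/96 of their Frobenius distance, whatever the dimension
(`frobenius_norm_sub_le_sum_abs_prob_sub`). For states of rank at most `r`, Frobenius distance
controls trace distance at the cost of a factor `√r` (`QState.traceDist_le`). It remains to learn a
classical distribution to `ℓ¹` error `O(γ)` from samples of which a `γ`-fraction is corrupted.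

The POVM works because, for traceless Hermitian `X` and `v` with entries `±1 ± i`, the number `⟨v,
Xv⟩` is a Rademacher quadratic form with zero diagonal. Its second moment controls the off-diagonal
part of `X`, and a hypercontractive fourth-moment bound makes its first absolute moment comparable
to its `L²` norm. Such vectors do not see the diagonal of `X`; mixing in the computational basis
measurement does.

The classical problem is solved by minimum distance estimation over a finite net
(`exists_robust_estimator`): each pair of candidates is compared by a bounded test, whose empirical
mean the adversary moves by at most `2γ`, and Chernoff with a union bound handles all pairs.
Purifications turn the low-rank states into a unit sphere of real dimension about `2dr`, so the net
has at most `(6/γ)^(2dr)` points (`exists_state_net`); its logarithm is the `d r log` term in `n`.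
-/

open scoped BigOperators

/-! ### Moments of Rademacher chaoses of degree at most two -/

/-- The real number `±1` attached to a sign. -/
def signVal (u : ℤˣ) : ℝ := ((u : ℤ) : ℝ)

lemma signVal_neg (u : ℤˣ) : signVal (-u) = -signVal u := by simp [signVal]

lemma signVal_mul_self (u : ℤˣ) : signVal u * signVal u = 1 := by
  rcases Int.units_eq_one_or u with rfl | rfl <;> simp [signVal]

lemma signVal_sq (u : ℤˣ) : signVal u ^ 2 = 1 := by rw [sq, signVal_mul_self]

section Rademacher

variable {ι : Type*} [DecidableEq ι]

/-- The function does not depend on the sign with index `a`. -/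
def FlipInvariant (a : ι) (F : (ι → ℤˣ) → ℝ) : Prop :=
  ∀ η, F (Function.update η a (-η a)) = F η

/-- A linear form in the signs with index in `s`. -/
def linChaos (c : ι → ℝ) (s : Finset ι) (η : ι → ℤˣ) : ℝ := ∑ b ∈ s, c b * signVal (η b)

/-- A quadratic form in the signs with index in `s`. -/
def quadChaos (B : ι → ι → ℝ) (s : Finset ι) (η : ι → ℤˣ) : ℝ :=
  ∑ a ∈ s, ∑ b ∈ s, B a b * (signVal (η a) * signVal (η b))

lemma flipInvariant_linChaos (c : ι → ℝ) {s : Finset ι} {a : ι} (ha : a ∉ s) :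
    FlipInvariant a (linChaos c s) := by
  intro η
  refine Finset.sum_congr rfl fun b hb => ?_
  rw [Function.update_of_ne (ne_of_mem_of_not_mem hb ha)]

lemma flipInvariant_quadChaos (B : ι → ι → ℝ) {s : Finset ι} {a : ι} (ha : a ∉ s) :
    FlipInvariant a (quadChaos B s) := by
  intro η
  refine Finset.sum_congr rfl fun b hb => Finset.sum_congr rfl fun c hc => ?_
  rw [Function.update_of_ne (ne_of_mem_of_not_mem hb ha),
    Function.update_of_ne (ne_of_mem_of_not_mem hc ha)]

lemma linChaos_insert (c : ι → ℝ) {s : Finset ι} {a : ι} (ha : a ∉ s) (η : ι → ℤˣ) :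
    linChaos c (insert a s) η = linChaos c s η + signVal (η a) * c a := by
  rw [linChaos, Finset.sum_insert ha, linChaos]
  ring

/-- With zero diagonal the form is affine in each single sign, which drives the inductions on
moments below. -/
lemma quadChaos_insert {B : ι → ι → ℝ} (hB : ∀ a b, B a b = B b a) (hB0 : ∀ a, B a a = 0)
    {s : Finset ι} {a : ι} (ha : a ∉ s) (η : ι → ℤˣ) :
    quadChaos B (insert a s) η =
      quadChaos B s η + signVal (η a) * linChaos (fun b => 2 * B a b) s η := by
  simp only [quadChaos, linChaos, Finset.sum_insert ha, hB0, Finset.sum_add_distrib,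
    Finset.mul_sum]
  have h : ∑ x ∈ s, B x a * (signVal (η x) * signVal (η a)) =
      ∑ x ∈ s, B a x * (signVal (η a) * signVal (η x)) :=
    Finset.sum_congr rfl fun x _ => by rw [hB x a]; ring
  have h' : ∑ x ∈ s, signVal (η a) * (2 * B a x * signVal (η x)) =
      2 * ∑ x ∈ s, B a x * (signVal (η a) * signVal (η x)) := by
    rw [Finset.mul_sum]
    exact Finset.sum_congr rfl fun x _ => by ring
  rw [h, h']
  ring

variable [Fintype ι]

/-- Flipping the sign at `a` permutes the sample space and negates the integrand. -/
lemma expect_signVal_mul_eq_zero {a : ι} {F : (ι → ℤˣ) → ℝ} (hF : FlipInvariant a F) :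
    𝔼 η, signVal (η a) * F η = 0 := by
  have hinv : Function.Involutive fun η : ι → ℤˣ => Function.update η a (-η a) := by
    intro η
    simp
  have h : 𝔼 η, signVal (η a) * F η = 𝔼 η, -(signVal (η a) * F η) := by
    refine Fintype.expect_equiv hinv.toPerm _ _ fun η => ?_
    simp [hF η, signVal_neg]
  rw [Finset.expect_neg_distrib] at h
  linarith

lemma expect_add_signVal_mul_sq {a : ι} {F G : (ι → ℤˣ) → ℝ} (hF : FlipInvariant a F)
    (hG : FlipInvariant a G) :
    𝔼 η, (F η + signVal (η a) * G η) ^ 2 = 𝔼 η, F η ^ 2 + 𝔼 η, G η ^ 2 := by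
  have h0 : 𝔼 η, signVal (η a) * (2 * F η * G η) = 0 :=
    expect_signVal_mul_eq_zero fun η => by rw [hF η, hG η]
  rw [← Finset.expect_add_distrib, ← add_zero (𝔼 η, (F η ^ 2 + G η ^ 2)), ← h0,
    ← Finset.expect_add_distrib]
  refine Finset.expect_congr rfl fun η _ => ?_
  linear_combination G η ^ 2 * signVal_sq (η a)

lemma expect_add_signVal_mul_pow_four {a : ι} {F G : (ι → ℤˣ) → ℝ} (hF : FlipInvariant a F)
    (hG : FlipInvariant a G) :
    𝔼 η, (F η + signVal (η a) * G η) ^ 4 =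
      𝔼 η, F η ^ 4 + 6 * 𝔼 η, F η ^ 2 * G η ^ 2 + 𝔼 η, G η ^ 4 := by
  have h0 : 𝔼 η, signVal (η a) * (4 * F η ^ 3 * G η + 4 * F η * G η ^ 3) = 0 :=
    expect_signVal_mul_eq_zero fun η => by rw [hF η, hG η]
  rw [Finset.mul_expect, ← Finset.expect_add_distrib, ← Finset.expect_add_distrib,
    ← add_zero (𝔼 η, (_ + _)), ← h0, ← Finset.expect_add_distrib]
  refine Finset.expect_congr rfl fun η _ => ?_
  linear_combination (6 * F η ^ 2 * G η ^ 2 + 4 * F η * G η ^ 3 * signVal (η a)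
    + G η ^ 4 * (signVal (η a) ^ 2 + 1)) * signVal_sq (η a)

lemma expect_linChaos_sq (c : ι → ℝ) (s : Finset ι) :
    𝔼 η, linChaos c s η ^ 2 = ∑ b ∈ s, c b ^ 2 := by
  induction s using Finset.induction_on with
  | empty => simp [linChaos]
  | insert a s ha ih =>
    simp_rw [linChaos_insert c ha]
    rw [expect_add_signVal_mul_sq (flipInvariant_linChaos c ha) (G := fun _ => c a)
      (fun _ => rfl), ih, Fintype.expect_const, Finset.sum_insert ha]
    ring

lemma expect_linChaos_pow_four_le (c : ι → ℝ) (s : Finset ι) :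
    𝔼 η, linChaos c s η ^ 4 ≤ 3 * (∑ b ∈ s, c b ^ 2) ^ 2 := by
  induction s using Finset.induction_on with
  | empty => simp [linChaos]
  | insert a s ha ih =>
    simp_rw [linChaos_insert c ha]
    rw [expect_add_signVal_mul_pow_four (flipInvariant_linChaos c ha) (G := fun _ => c a)
      (fun _ => rfl), Fintype.expect_const, Finset.sum_insert ha, ← Finset.expect_mul,
      expect_linChaos_sq]
    nlinarith [sq_nonneg (c a ^ 2)]

lemma expect_quadChaos_sq {B : ι → ι → ℝ} (hB : ∀ a b, B a b = B b a) (hB0 : ∀ a, B a a = 0)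
    (s : Finset ι) :
    𝔼 η, quadChaos B s η ^ 2 = 2 * ∑ a ∈ s, ∑ b ∈ s, B a b ^ 2 := by
  induction s using Finset.induction_on with
  | empty => simp [quadChaos]
  | insert a s ha ih =>
    simp_rw [quadChaos_insert hB hB0 ha]
    rw [expect_add_signVal_mul_sq (flipInvariant_quadChaos B ha) (flipInvariant_linChaos _ ha), ih,
      expect_linChaos_sq]
    simp only [Finset.sum_insert ha, hB0, Finset.sum_add_distrib, mul_pow, ← Finset.mul_sum]
    simp_rw [fun x => hB x a]
    ring

lemma sq_expect_mul_le {α : Type*} [Fintype α] [Nonempty α] (f g : α → ℝ) :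
    (𝔼 x, f x * g x) ^ 2 ≤ (𝔼 x, f x ^ 2) * 𝔼 x, g x ^ 2 := by
  simp only [Fintype.expect_eq_sum_div_card]
  have hc : (0 : ℝ) < Fintype.card α := by exact_mod_cast Fintype.card_pos
  rw [div_pow, div_mul_div_comm, ← sq]
  gcongr
  exact Finset.sum_mul_sq_le_sq_mul_sq _ _ _

/-- Bonami's induction on the number of signs: odd powers of the new sign average out, and
Cauchy–Schwarz bounds the mixed term by the fourth moments of the old form and of the linear part.
-/
lemma expect_quadChaos_pow_four_le {B : ι → ι → ℝ} (hB : ∀ a b, B a b = B b a)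
    (hB0 : ∀ a, B a a = 0) (s : Finset ι) :
    𝔼 η, quadChaos B s η ^ 4 ≤ 81 * (𝔼 η, quadChaos B s η ^ 2) ^ 2 := by
  induction s using Finset.induction_on with
  | empty => simp [quadChaos]
  | insert a s ha ih =>
    simp_rw [quadChaos_insert hB hB0 ha]
    have hQ := flipInvariant_quadChaos B ha
    have hL := flipInvariant_linChaos (fun b => 2 * B a b) ha
    rw [expect_add_signVal_mul_pow_four hQ hL, expect_add_signVal_mul_sq hQ hL]
    have h4 := expect_linChaos_pow_four_le (fun b => 2 * B a b) s
    rw [← expect_linChaos_sq] at h4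
    have hcs := sq_expect_mul_le (fun η => quadChaos B s η ^ 2)
      (fun η => linChaos (fun b => 2 * B a b) s η ^ 2)
    simp only [← pow_mul] at hcs
    norm_num at hcs
    have hq0 : 0 ≤ 𝔼 η, quadChaos B s η ^ 2 := Finset.expect_nonneg fun η _ => sq_nonneg _
    have hl0 : 0 ≤ 𝔼 η, linChaos (fun b => 2 * B a b) s η ^ 2 :=
      Finset.expect_nonneg fun η _ => sq_nonneg _
    have hq4 : 0 ≤ 𝔼 η, quadChaos B s η ^ 4 := Finset.expect_nonneg fun η _ => by positivity
    have hl4 : 0 ≤ 𝔼 η, linChaos (fun b => 2 * B a b) s η ^ 4 :=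
      Finset.expect_nonneg fun η _ => by positivity
    generalize 𝔼 η, quadChaos B s η ^ 2 = q2 at *
    generalize 𝔼 η, quadChaos B s η ^ 4 = q4 at *
    generalize 𝔼 η, linChaos (fun b => 2 * B a b) s η ^ 2 = l2 at *
    generalize 𝔼 η, linChaos (fun b => 2 * B a b) s η ^ 4 = l4 at *
    -- Cauchy–Schwarz gives `√(81 * 3) < 27`, and `6 * 27 = 2 * 81` is the cross term of `81 * (q2 +
    -- l2) ^ 2`.
    have hm : 𝔼 η, quadChaos B s η ^ 2 * linChaos (fun b => 2 * B a b) s η ^ 2 ≤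
        27 * (q2 * l2) := by
      refine abs_le_of_sq_le_sq' (hcs.trans ?_) (by positivity) |>.2
      calc q4 * l4 ≤ (81 * q2 ^ 2) * (3 * l2 ^ 2) := by gcongr
        _ ≤ (27 * (q2 * l2)) ^ 2 := by nlinarith [sq_nonneg (q2 * l2)]
    nlinarith [sq_nonneg l2]

/-- The first absolute moment of a quadratic chaos controls its second moment. -/
lemma sqrt_expect_sq_le_expect_abs_quadChaos {B : ι → ι → ℝ} (hB : ∀ a b, B a b = B b a)
    (hB0 : ∀ a, B a a = 0) (s : Finset ι) :
    √(𝔼 η, quadChaos B s η ^ 2) ≤ 24 * 𝔼 η, |quadChaos B s η| := by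
  have h4 := expect_quadChaos_pow_four_le hB hB0 s
  have hq0 : 0 ≤ 𝔼 η, quadChaos B s η ^ 2 := Finset.expect_nonneg fun η _ => sq_nonneg _
  set m := √(𝔼 η, quadChaos B s η ^ 2) with hm
  have hm2 : 𝔼 η, quadChaos B s η ^ 2 = m ^ 2 := (Real.sq_sqrt hq0).symm
  have hm0 : 0 ≤ m := Real.sqrt_nonneg _
  rcases hm0.eq_or_lt with h0 | hpos
  · rw [← h0]
    exact mul_nonneg (by norm_num) (Finset.expect_nonneg fun η _ => abs_nonneg _)
  -- Averaging this pointwise bound gives `(18² - 81) m⁴ ≤ 18³ m³ E|Q|`, and `18³ / (18² - 81) =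
  -- 24`.
  have hpt : ∀ η, (18 * m) ^ 2 * quadChaos B s η ^ 2 - quadChaos B s η ^ 4 ≤
      (18 * m) ^ 3 * |quadChaos B s η| := by
    intro η
    rw [← sq_abs (quadChaos B s η), ← (show Even 4 by decide).pow_abs]
    have ha := abs_nonneg (quadChaos B s η)
    generalize |quadChaos B s η| = u at *
    have ht : 0 < 18 * m := by positivity
    generalize 18 * m = t at *
    have : 0 ≤ t ^ 3 - t ^ 2 * u + u ^ 3 := by
      rcases le_total u t with h | h
      · nlinarith [mul_nonneg (sq_nonneg t) (sub_nonneg.2 h), pow_nonneg ha 3]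
      · nlinarith [mul_nonneg (mul_nonneg ha (sub_nonneg.2 h)) (add_nonneg ha ht.le),
          pow_pos ht 3]
    nlinarith [mul_nonneg ha this]
  have hE := Finset.expect_le_expect (s := Finset.univ) fun η (_ : η ∈ Finset.univ) => hpt η
  rw [Finset.expect_sub_distrib, ← Finset.mul_expect, ← Finset.mul_expect, hm2] at hE
  rw [hm2] at h4
  generalize 𝔼 η, |quadChaos B s η| = e at *
  have h3 : m ^ 3 * m ≤ m ^ 3 * (24 * e) := by nlinarith
  exact le_of_mul_le_mul_left h3 (by positivity)

end Rademacher

/-! ### A corruption-robust minimum distance estimator for finitely many distributions -/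

section Estimation

lemma sum_biUnion_le_sum {α κ : Type*} [DecidableEq α] {w : α → ℝ} (hw : ∀ x, 0 ≤ w x) (s : Finset κ)
    (t : κ → Finset α) : ∑ x ∈ s.biUnion t, w x ≤ ∑ a ∈ s, ∑ x ∈ t a, w x := by
  classical
  induction s using Finset.induction_on with
  | empty => simp
  | insert a s ha ih =>
    rw [Finset.biUnion_insert, Finset.sum_insert ha]
    have h := Finset.sum_union_inter (s₁ := t a) (s₂ := s.biUnion t) (f := w)
    have h' : 0 ≤ ∑ x ∈ t a ∩ s.biUnion t, w x := Finset.sum_nonneg fun x _ => hw x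
    linarith

variable {X : Type*}

open Classical in
lemma sum_test_le_of_corruption {f : X → ℝ} (hf : ∀ x, |f x| ≤ 1) {n : ℕ} {x y : Fin n → X}
    {k : ℝ} (h : ((Finset.univ.filter fun i => y i ≠ x i).card : ℝ) ≤ k) :
    ∑ i, f (y i) ≤ ∑ i, f (x i) + 2 * k := by
  have hpt : ∀ i, f (y i) - f (x i) ≤ if y i ≠ x i then 2 else 0 := by
    intro i
    split_ifs with hi
    · linarith [(abs_le.1 (hf (y i))).2, (abs_le.1 (hf (x i))).1]
    · rw [not_not.1 hi, sub_self]
  have := Finset.sum_le_sum fun i (_ : i ∈ Finset.univ) => hpt i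
  rw [Finset.sum_sub_distrib, ← Finset.sum_filter, Finset.sum_const, nsmul_eq_mul] at this
  linarith

variable [Fintype X]

/-- The centred test is at most 2 in absolute value, so `l ≤ 1 / 2` allows `exp u ≤ 1 + u + u²`; the
linear term vanishes and the variance is at most 1. -/
lemma sum_mul_exp_le {p f : X → ℝ} (hp : ∀ x, 0 ≤ p x) (hp1 : ∑ x, p x = 1)
    (hf : ∀ x, |f x| ≤ 1) {l : ℝ} (hl0 : 0 ≤ l) (hl : l ≤ 1 / 2) :
    ∑ x, p x * Real.exp (l * (f x - ∑ z, p z * f z)) ≤ Real.exp (l ^ 2) := by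
  set μ := ∑ z, p z * f z with hμ
  have hμ1 : |μ| ≤ 1 := by
    refine (Finset.abs_sum_le_sum_abs _ _).trans ?_
    rw [← hp1]
    refine Finset.sum_le_sum fun x _ => ?_
    rw [abs_mul, abs_of_nonneg (hp x)]
    exact mul_le_of_le_one_right (hp x) (hf x)
  have hpt : ∀ x, p x * Real.exp (l * (f x - μ)) ≤
      p x * (1 + l * (f x - μ) + l ^ 2 * (f x - μ) ^ 2) := by
    intro x
    refine mul_le_mul_of_nonneg_left ?_ (hp x)
    have hY : |f x - μ| ≤ 2 := (abs_sub _ _).trans (by linarith [hf x])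
    have h1 : |l * (f x - μ)| ≤ 1 := by
      rw [abs_mul, abs_of_nonneg hl0]
      nlinarith [abs_nonneg (f x - μ)]
    have := (abs_le.1 (Real.abs_exp_sub_one_sub_id_le h1)).2
    nlinarith
  have hvar : ∑ x, p x * (f x - μ) ^ 2 ≤ 1 := by
    have h : ∑ x, p x * (f x - μ) ^ 2 = ∑ x, p x * f x ^ 2 - μ ^ 2 := by
      have : ∀ x, p x * (f x - μ) ^ 2 = p x * f x ^ 2 - 2 * μ * (p x * f x) + μ ^ 2 * p x :=
        fun x => by ring
      simp_rw [this]
      rw [Finset.sum_add_distrib, Finset.sum_sub_distrib, ← Finset.mul_sum, ← Finset.mul_sum,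
        hp1, ← hμ]
      ring
    have h2 : ∑ x, p x * f x ^ 2 ≤ ∑ x, p x :=
      Finset.sum_le_sum fun x _ => 
        mul_le_of_le_one_right (hp x) ((sq_le_one_iff_abs_le_one _).2 (hf x))
    nlinarith [sq_nonneg μ]
  calc ∑ x, p x * Real.exp (l * (f x - μ))
      ≤ ∑ x, p x * (1 + l * (f x - μ) + l ^ 2 * (f x - μ) ^ 2) :=
        Finset.sum_le_sum fun x _ => hpt x
    _ = ∑ x, p x + l * (∑ x, p x * f x - μ * ∑ x, p x) + l ^ 2 * ∑ x, p x * (f x - μ) ^ 2 := by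
        simp only [Finset.mul_sum, ← Finset.sum_add_distrib, ← Finset.sum_sub_distrib]
        exact Finset.sum_congr rfl fun x _ => by ring
    _ ≤ l ^ 2 + 1 := by
        rw [hp1, ← hμ]
        nlinarith [sq_nonneg l]
    _ ≤ Real.exp (l ^ 2) := Real.add_one_le_exp _

open Classical in
/-- Chernoff's bound for the empirical mean of a test with values in `[-1, 1]`. -/
lemma sum_prod_filter_lt_le {p f : X → ℝ} (hp : ∀ x, 0 ≤ p x) (hp1 : ∑ x, p x = 1)
    (hf : ∀ x, |f x| ≤ 1) {t : ℝ} (ht0 : 0 ≤ t) (ht : t ≤ 1) (n : ℕ) :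
    ∑ x ∈ Finset.univ.filter fun x : Fin n → X => n * (∑ z, p z * f z + t) < ∑ i, f (x i),
      ∏ i, p (x i) ≤ Real.exp (-(n * t ^ 2 / 4)) := by
  set μ := ∑ z, p z * f z with hμ
  have hw : ∀ x : Fin n → X, 0 ≤ ∏ i, p (x i) := fun x => Finset.prod_nonneg fun i _ => hp _
  -- Exponential Markov with parameter `l = t / 2`, the minimiser of `l² - l t`.
  have key : ∀ x : Fin n → X, n * (μ + t) < ∑ i, f (x i) →
      ∏ i, p (x i) ≤
        Real.exp (-(n * t ^ 2 / 2)) * ∏ i, (p (x i) * Real.exp (t / 2 * (f (x i) - μ))) := by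
    intro x hx
    rw [Finset.prod_mul_distrib, ← Real.exp_sum, mul_left_comm, ← Real.exp_add]
    refine le_mul_of_one_le_right (hw x) (Real.one_le_exp ?_)
    rw [← Finset.mul_sum, Finset.sum_sub_distrib]
    simp only [Finset.sum_const, Finset.card_univ, Fintype.card_fin, nsmul_eq_mul]
    nlinarith
  calc _ ≤ ∑ x ∈ Finset.univ.filter fun x : Fin n → X => n * (μ + t) < ∑ i, f (x i),
        Real.exp (-(n * t ^ 2 / 2)) * ∏ i, (p (x i) * Real.exp (t / 2 * (f (x i) - μ))) :=
        Finset.sum_le_sum fun x hx => key x (Finset.mem_filter.1 hx).2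
    _ ≤ ∑ x : Fin n → X,
        Real.exp (-(n * t ^ 2 / 2)) * ∏ i, (p (x i) * Real.exp (t / 2 * (f (x i) - μ))) :=
        Finset.sum_le_sum_of_subset_of_nonneg (Finset.filter_subset _ _) fun x _ _ =>
          mul_nonneg (Real.exp_pos _).le
            (Finset.prod_nonneg fun i _ => mul_nonneg (hp _) (Real.exp_pos _).le)
    _ = Real.exp (-(n * t ^ 2 / 2)) * (∑ z, p z * Real.exp (t / 2 * (f z - μ))) ^ n := by
        rw [← Finset.mul_sum, Finset.sum_pow', Fintype.piFinset_univ]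
    _ ≤ Real.exp (-(n * t ^ 2 / 2)) * Real.exp ((t / 2) ^ 2) ^ n := by
        gcongr
        · exact Finset.sum_nonneg fun z _ => mul_nonneg (hp _) (Real.exp_pos _).le
        · exact sum_mul_exp_le hp hp1 hf (by linarith) (by linarith)
    _ = Real.exp (-(n * t ^ 2 / 4)) := by
        rw [← Real.exp_nat_mul, ← Real.exp_add]
        congr 1
        ring

open Classical in
/-- For finitely many candidate distributions there is an estimator which, from `n` samples of a
distribution close to a candidate, a `γ`-fraction of them corrupted, finds a close candidate. -/
theorem exists_robust_estimator {Θ : Type*} (N : Finset Θ) (hN : N.Nonempty) (q : Θ → X → ℝ)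
    {γ : ℝ} (hγ0 : 0 < γ) (hγ1 : γ ≤ 1) {n : ℕ} (hn : 0 < n) :
    ∃ est : (Fin n → X) → Θ, (∀ y, est y ∈ N) ∧
      ∀ p : X → ℝ, (∀ x, 0 ≤ p x) → ∑ x, p x = 1 → (∃ σ ∈ N, ∑ x, |p x - q σ x| ≤ γ) →
        ∃ G : Finset (Fin n → X),
          1 - (N.card : ℝ) ^ 2 * Real.exp (-(n * γ ^ 2 / 4)) ≤ ∑ x ∈ G, ∏ i, p (x i) ∧
          ∀ x ∈ G, ∀ y, ((Finset.univ.filter fun i => y i ≠ x i).card : ℝ) ≤ γ * n →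
            ∑ z, |q (est y) z - p z| ≤ 9 * γ := by
  have hn' : (0 : ℝ) < n := by exact_mod_cast hn
  obtain ⟨τ₀, hτ₀⟩ := hN
  -- The sign of the difference is the test that attains the `ℓ¹` distance between two candidates.
  let f : Θ × Θ → X → ℝ := fun a x => (SignType.sign (q a.1 x - q a.2 x) : ℝ)
  have hf : ∀ a x, |f a x| ≤ 1 := by
    intro a x
    simp only [f]
    rcases lt_trichotomy (q a.1 x - q a.2 x) 0 with h | h | h
    · simp [sign_neg h]
    · simp [h]
    · simp [sign_pos h]
  have hf_swap : ∀ a x, f a.swap x = -f a x := by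
    intro a x
    simp only [f, Prod.fst_swap, Prod.snd_swap]
    rw [← neg_sub, Left.sign_neg]
    simp
  -- The slack `4γ` is `γ` for sampling, `2γ` for corruption and `γ` for the distance from `p` to
  -- the net.
  let Fits : (Fin n → X) → Θ → Prop := fun y τ =>
    ∀ a ∈ N ×ˢ N, ∑ i, f a (y i) ≤ n * (∑ z, q τ z * f a z + 4 * γ)
  -- The default `τ₀` is never used on the good event, where the candidate near `p` fits.
  refine ⟨fun y => if h : ∃ τ ∈ N, Fits y τ then h.choose else τ₀, fun y => ?_, ?_⟩
  · dsimp only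
    split_ifs with h
    · exact h.choose_spec.1
    · exact hτ₀
  rintro p hp hp1 ⟨σ, hσ, hσp⟩
  let Bad : Θ × Θ → Finset (Fin n → X) := fun a =>
    Finset.univ.filter fun x => n * (∑ z, p z * f a z + γ) < ∑ i, f a (x i)
  refine ⟨((N ×ˢ N).biUnion Bad)ᶜ, ?_, ?_⟩
  · have htot : ∑ x : Fin n → X, ∏ i, p (x i) = 1 := by
      rw [← Fintype.piFinset_univ, ← Finset.sum_pow', hp1, one_pow]
    have hbad : ∑ x ∈ (N ×ˢ N).biUnion Bad, ∏ i, p (x i) ≤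
        (N.card : ℝ) ^ 2 * Real.exp (-(n * γ ^ 2 / 4)) := by
      calc _ ≤ ∑ a ∈ N ×ˢ N, ∑ x ∈ Bad a, ∏ i, p (x i) :=
            sum_biUnion_le_sum (fun x => Finset.prod_nonneg fun i _ => hp _) _ _
        _ ≤ ∑ a ∈ N ×ˢ N, Real.exp (-(n * γ ^ 2 / 4)) :=
            Finset.sum_le_sum fun a _ => sum_prod_filter_lt_le hp hp1 (hf a) hγ0.le hγ1 n
        _ = _ := by
            rw [Finset.sum_const, Finset.card_product, nsmul_eq_mul, Nat.cast_mul, ← sq]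
    have := Finset.sum_add_sum_compl ((N ×ˢ N).biUnion Bad) fun x : Fin n → X => ∏ i, p (x i)
    linarith
  · intro x hx y hy
    have hgood : ∀ a ∈ N ×ˢ N, ∑ i, f a (y i) ≤ n * (∑ z, p z * f a z + 3 * γ) := by
      intro a ha
      have h1 : ∑ i, f a (x i) ≤ n * (∑ z, p z * f a z + γ) := by
        by_contra! hlt
        exact Finset.mem_compl.1 hx
          (Finset.mem_biUnion.2 ⟨a, ha, Finset.mem_filter.2 ⟨Finset.mem_univ _, hlt⟩⟩)
      have h2 := sum_test_le_of_corruption (hf a) hy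
      linarith
    have hfit : Fits y σ := by
      intro a ha
      refine (hgood a ha).trans (mul_le_mul_of_nonneg_left ?_ hn'.le)
      have h : ∑ z, p z * f a z - ∑ z, q σ z * f a z ≤ ∑ z, |p z - q σ z| := by
        rw [← Finset.sum_sub_distrib]
        refine Finset.sum_le_sum fun z _ => ?_
        rw [← sub_mul]
        refine (le_abs_self _).trans ?_
        rw [abs_mul]
        exact mul_le_of_le_one_right (abs_nonneg _) (hf a z)
      linarith
    have hex : ∃ τ ∈ N, Fits y τ := ⟨σ, hσ, hfit⟩
    simp only [dif_pos hex]
    obtain ⟨hτ, hτfit⟩ := hex.choose_spec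
    generalize hex.choose = τ at hτ hτfit ⊢
    -- The test of `(σ, τ)` is minus that of `(τ, σ)`, so adding the two fits cancels the empirical
    -- sums and leaves `ℓ¹` distance at most `8γ`.
    have h1 := hfit (τ, σ) (Finset.mk_mem_product hτ hσ)
    have h2 := hτfit (σ, τ) (Finset.mk_mem_product hσ hτ)
    have h3 : ∀ z, f (σ, τ) z = -f (τ, σ) z := fun z => hf_swap (τ, σ) z
    simp only [h3, mul_neg, Finset.sum_neg_distrib] at h2
    have h4 : n * (∑ z, q τ z * f (τ, σ) z - ∑ z, q σ z * f (τ, σ) z) ≤ n * (8 * γ) := by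
      linarith
    have h5 := le_of_mul_le_mul_left h4 hn'
    have h6 : ∑ z, |q τ z - q σ z| = ∑ z, q τ z * f (τ, σ) z - ∑ z, q σ z * f (τ, σ) z := by
      rw [← Finset.sum_sub_distrib]
      refine Finset.sum_congr rfl fun z _ => ?_
      rw [← sub_mul, self_mul_sign]
    have h7 : ∑ z, |q τ z - p z| ≤ ∑ z, |q τ z - q σ z| + ∑ z, |p z - q σ z| := by
      rw [← Finset.sum_add_distrib]
      refine Finset.sum_le_sum fun z _ => ?_
      rw [abs_sub_comm (p z)]
      exact abs_sub_le _ _ _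
    linarith

end Estimation

/-! ### Finite nets -/

section Net

open MeasureTheory Metric Module

variable {E : Type*} [NormedAddCommGroup E] [NormedSpace ℝ E] [FiniteDimensional ℝ E]

/-- A volume bound for the cardinality of a separated subset of the unit ball. -/
lemma card_le_of_separated_unit_ball (s : Finset E) (hs : ∀ c ∈ s, ‖c‖ ≤ 1) {η : ℝ} (hη0 : 0 < η)
    (hη1 : η ≤ 1) (h : ∀ c ∈ s, ∀ d ∈ s, c ≠ d → η ≤ ‖c - d‖) :
    (s.card : ℝ) ≤ (3 / η) ^ finrank ℝ E := by
  borelize E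
  let μ : Measure E := Measure.addHaar
  have hD : Set.Pairwise (s : Set E) (Function.onFun Disjoint fun c => ball (c : E) (η / 2)) := by
    rintro c hc d hd hcd
    apply ball_disjoint_ball
    rw [dist_eq_norm, add_halves]
    exact h c hc d hd hcd
  have hsub : (⋃ c ∈ s, ball (c : E) (η / 2)) ⊆ ball (0 : E) (3 / 2) := by
    refine Set.iUnion₂_subset fun x hx => ball_subset_ball' ?_
    rw [dist_zero_right]
    linarith [hs x hx]
  have hI : (s.card : ENNReal) * ENNReal.ofReal ((η / 2) ^ finrank ℝ E) * μ (ball 0 1) ≤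
      ENNReal.ofReal ((3 / 2) ^ finrank ℝ E) * μ (ball 0 1) :=
    calc
      _ = μ (⋃ c ∈ s, ball (c : E) (η / 2)) := by
        rw [measure_biUnion_finset hD fun c _ => measurableSet_ball]
        simp only [μ.addHaar_ball_of_pos _ (half_pos hη0), Finset.sum_const, nsmul_eq_mul,
          mul_assoc]
      _ ≤ μ (ball (0 : E) (3 / 2)) := measure_mono hsub
      _ = _ := μ.addHaar_ball_of_pos _ (by norm_num)
  have hJ := (ENNReal.mul_le_mul_iff_left (measure_ball_pos _ _ zero_lt_one).ne'
    measure_ball_lt_top.ne).1 hI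
  have hK := ENNReal.toReal_le_of_le_ofReal (by positivity) hJ
  rw [ENNReal.toReal_mul, ENNReal.toReal_natCast, ENNReal.toReal_ofReal (by positivity)] at hK
  rw [show 3 / η = (3 / 2) / (η / 2) by field_simp, div_pow, le_div_iff₀ (by positivity)]
  exact hK

/-- A maximal separated subset is a net; the volume bound makes the packing number finite, so that
one exists. -/
lemma exists_finite_net (A : Set E) (hA : ∀ x ∈ A, ‖x‖ ≤ 1) {η : ℝ} (hη0 : 0 < η) (hη1 : η ≤ 1) :
    ∃ N : Finset E, ↑N ⊆ A ∧ (N.card : ℝ) ≤ (3 / η) ^ finrank ℝ E ∧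
      ∀ x ∈ A, ∃ c ∈ N, ‖x - c‖ ≤ η := by
  let e : NNReal := ⟨η, hη0.le⟩
  have hsep : ∀ s : Finset E, ↑s ⊆ A → IsSeparated e (s : Set E) →
      (s.card : ℝ) ≤ (3 / η) ^ finrank ℝ E := by
    intro s hs hsep
    refine card_le_of_separated_unit_ball s (fun c hc => hA c (hs hc)) hη0 hη1 ?_
    intro c hc d hd hcd
    have h : e < edist c d := hsep hc hd hcd
    rw [edist_nndist, ENNReal.coe_lt_coe, ← NNReal.coe_lt_coe, coe_nndist, dist_eq_norm] at h
    exact h.le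
  have hpack : packingNumber e A ≠ ⊤ := by
    intro htop
    obtain ⟨k, hk⟩ := exists_nat_gt ((3 / η) ^ finrank ℝ E)
    have hlt : (k : ℕ∞) < packingNumber e A := htop ▸ ENat.natCast_lt_top k
    simp only [packingNumber, lt_iSup_iff] at hlt
    obtain ⟨C, hCA, hCs, hkC⟩ := hlt
    obtain ⟨t, htC, ht⟩ := Set.exists_subset_encard_eq hkC.le
    have htf : t.Finite := Set.finite_of_encard_eq_coe ht
    have h := hsep htf.toFinset (by simpa using htC.trans hCA)
      (by rw [htf.coe_toFinset]; exact Set.Pairwise.mono htC hCs)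
    rw [htf.encard_eq_coe_toFinset_card] at ht
    rw [Nat.cast_inj.1 ht] at h
    linarith
  have hfin : (maximalSeparatedSet e A).Finite :=
    Set.encard_ne_top_iff.1 (by rwa [encard_maximalSeparatedSet hpack])
  refine ⟨hfin.toFinset, by simpa using maximalSeparatedSet_subset, hsep _ (by simpa using
    maximalSeparatedSet_subset) (by simpa using isSeparated_maximalSeparatedSet), fun x hx => ?_⟩
  obtain ⟨c, hc, hxc⟩ := isCover_maximalSeparatedSet hpack hx
  refine ⟨c, by simpa using hc, ?_⟩
  have h : edist x c ≤ e := hxc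
  rwa [edist_nndist, ENNReal.coe_le_coe, ← NNReal.coe_le_coe, coe_nndist, dist_eq_norm] at h

end Net

/-! ### A net of low-rank states -/

section StateNet

open Matrix
open scoped Matrix.Norms.Frobenius

lemma frobenius_norm_sq {m n : Type*} [Fintype m] [Fintype n] (A : Matrix m n ℂ) :
    ‖A‖ ^ 2 = ∑ i, ∑ j, ‖A i j‖ ^ 2 := by
  rw [frobenius_norm_def, ← Real.sqrt_eq_rpow, Real.sq_sqrt]
  · simp
  · positivity

lemma trace_mul_conjTranspose_self {m n : Type*} [Fintype m] [Fintype n] (A : Matrix m n ℂ) :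
    (A * Aᴴ).trace = ((‖A‖ ^ 2 : ℝ) : ℂ) := by
  rw [frobenius_norm_sq]
  simp only [trace, diag_apply, mul_apply, conjTranspose_apply, Complex.ofReal_sum]
  refine Finset.sum_congr rfl fun i _ => Finset.sum_congr rfl fun j _ => ?_
  rw [Complex.star_def, Complex.mul_conj, Complex.normSq_eq_norm_sq]

lemma re_trace_mul_conjTranspose_mul {m n : Type*} [Fintype m] [Fintype n]
    (A : Matrix m n ℂ) (L : Matrix m m ℂ) :
    (A * Aᴴ * (Lᴴ * L)).trace.re = ‖L * A‖ ^ 2 := by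
  have h : (A * Aᴴ * (Lᴴ * L)).trace = (L * A * (L * A)ᴴ).trace := by
    rw [conjTranspose_mul, ← Matrix.mul_assoc, trace_mul_comm]
    simp only [Matrix.mul_assoc]
  rw [h, trace_mul_conjTranspose_self, Complex.ofReal_re]

/-- A positive semidefinite matrix of rank at most `r` factors through `ℂ^r`. -/
lemma Matrix.PosSemidef.exists_eq_mul_conjTranspose {m : Type*} [Fintype m] [DecidableEq m]
    {P : Matrix m m ℂ} (hP : P.PosSemidef) {r : ℕ} (hr : P.rank ≤ r) :
    ∃ A : Matrix m (Fin r) ℂ, P = A * Aᴴ := by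
  set ev := hP.isHermitian.eigenvalues with hev
  have hcard : Fintype.card {i // ev i ≠ 0} ≤ Fintype.card (Fin r) := by
    rw [← hP.isHermitian.rank_eq_card_non_zero_eigs, Fintype.card_fin]
    exact hr
  obtain ⟨e⟩ := Function.Embedding.nonempty_of_card_le hcard
  -- `V` embeds the indices of nonzero eigenvalues into `Fin r`, so `V * Vᴴ` projects onto them and
  -- is absorbed by `D`.
  let V : Matrix m (Fin r) ℂ := fun i k =>
    if h : ev i ≠ 0 then (if e ⟨i, h⟩ = k then 1 else 0) else 0
  let D : Matrix m m ℂ := diagonal fun i => ((√(ev i) : ℝ) : ℂ)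
  let U : Matrix m m ℂ := hP.isHermitian.eigenvectorUnitary
  have hD : Dᴴ = D := by
    simp only [D, diagonal_conjTranspose]
    congr 1
    ext i
    simp
  have hVV : V * Vᴴ = diagonal fun i => if ev i ≠ 0 then (1 : ℂ) else 0 := by
    ext i j
    rw [mul_apply, diagonal_apply]
    have hV : ∀ i k, V i k = if h : ev i ≠ 0 then (if e ⟨i, h⟩ = k then 1 else 0) else 0 :=
      fun _ _ => rfl
    simp only [conjTranspose_apply, hV]
    by_cases hi : ev i = 0
    · simp [hi]
    by_cases hj : ev j = 0
    · have hij : i ≠ j := fun h => hi (h ▸ hj)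
      simp [hj, hij]
    simp [hi, hj, eq_comm]
  have hDD : D * (V * Vᴴ) * D = diagonal (RCLike.ofReal ∘ ev) := by
    rw [hVV, diagonal_mul_diagonal, diagonal_mul_diagonal]
    congr 1
    ext i
    by_cases hi : ev i = 0
    · simp [hi]
    · have h := Real.mul_self_sqrt (hP.eigenvalues_nonneg i)
      simp only [ne_eq, hi, not_false_eq_true, if_true, mul_one, Function.comp_apply]
      rw [← Complex.ofReal_mul, h]
      rfl
  refine ⟨U * D * V, ?_⟩
  conv_lhs => rw [hP.isHermitian.spectral_theorem, Unitary.conjStarAlgAut_apply]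
  rw [← hev, ← hDD, conjTranspose_mul, conjTranspose_mul, hD]
  simp only [Matrix.mul_assoc]
  rfl

variable {d : ℕ}

/-- The state with a given purification. -/
def QState.ofFactor {r : ℕ} (A : Matrix (Fin d) (Fin r) ℂ) (hA : ‖A‖ = 1) : QState d where
  mat := A * Aᴴ
  posSemidef := posSemidef_self_mul_conjTranspose A
  trace_eq_one := by rw [trace_mul_conjTranspose_self, hA]; simp

lemma QState.rank_ofFactor_le {r : ℕ} (A : Matrix (Fin d) (Fin r) ℂ) (hA : ‖A‖ = 1) :
    (QState.ofFactor A hA).mat.rank ≤ r :=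
  (rank_mul_le_left _ _).trans ((rank_le_width A).trans (by simp))

lemma QState.exists_eq_ofFactor (ρ : QState d) {r : ℕ} (hr : ρ.mat.rank ≤ r) :
    ∃ (A : Matrix (Fin d) (Fin r) ℂ) (hA : ‖A‖ = 1), ρ = QState.ofFactor A hA := by
  obtain ⟨A, hA⟩ := ρ.posSemidef.exists_eq_mul_conjTranspose hr
  have h1 : ‖A‖ = 1 := by
    have h := ρ.trace_eq_one
    rw [hA, trace_mul_conjTranspose_self] at h
    have h' : ‖A‖ ^ 2 = 1 := by exact_mod_cast h
    nlinarith [norm_nonneg A]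
  refine ⟨A, h1, ?_⟩
  cases ρ
  simp only [QState.ofFactor]
  congr

/-- Nearby purifications give nearby outcome distributions. -/
lemma POVM.sum_abs_prob_sub_le {X : Type} [Fintype X] (M : POVM d X) {r : ℕ}
    (A B : Matrix (Fin d) (Fin r) ℂ) (hA : ‖A‖ = 1) (hB : ‖B‖ = 1) :
    ∑ x, |M.prob (QState.ofFactor A hA) x - M.prob (QState.ofFactor B hB) x| ≤
      2 * ‖A - B‖ := by
  have hL : ∀ x, ∃ L : Matrix (Fin d) (Fin d) ℂ, M.effect x = Lᴴ * L := by
    intro x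
    obtain ⟨A, hA⟩ := (M.posSemidef x).exists_eq_mul_conjTranspose
      (rank_le_width _)
    exact ⟨Aᴴ, by rw [hA, conjTranspose_conjTranspose]⟩
  choose L hL using hL
  have hsum : ∀ C : Matrix (Fin d) (Fin r) ℂ, ∑ x, ‖L x * C‖ ^ 2 = ‖C‖ ^ 2 := by
    intro C
    simp_rw [← re_trace_mul_conjTranspose_mul, ← hL]
    rw [← Complex.re_sum, ← trace_sum, ← Finset.mul_sum, M.sum_eq_one, Matrix.mul_one,
      trace_mul_conjTranspose_self, Complex.ofReal_re]
  -- Probabilities are squared norms `‖L x * A‖ ^ 2`; factor the difference of squares, then sum by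
  -- Cauchy–Schwarz using completeness `hsum`.
  have hpt : ∀ x, |M.prob (QState.ofFactor A hA) x - M.prob (QState.ofFactor B hB) x| ≤
      ‖L x * (A - B)‖ * (‖L x * A‖ + ‖L x * B‖) := by
    intro x
    simp only [POVM.prob, QState.ofFactor]
    rw [hL, re_trace_mul_conjTranspose_mul, re_trace_mul_conjTranspose_mul, sq_sub_sq, abs_mul,
      abs_of_nonneg (by positivity), mul_comm]
    gcongr
    rw [Matrix.mul_sub]
    exact abs_norm_sub_norm_le _ _
  refine (Finset.sum_le_sum fun x _ => hpt x).trans ?_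
  refine abs_le_of_sq_le_sq' ((Finset.sum_mul_sq_le_sq_mul_sq _ _ _).trans ?_) (by positivity) |>.2
  rw [hsum]
  have h4 : ∑ x, (‖L x * A‖ + ‖L x * B‖) ^ 2 ≤ 4 := by
    calc _ ≤ ∑ x, (2 * ‖L x * A‖ ^ 2 + 2 * ‖L x * B‖ ^ 2) :=
          Finset.sum_le_sum fun x _ => by nlinarith [sq_nonneg (‖L x * A‖ - ‖L x * B‖)]
      _ = 4 := by
          rw [Finset.sum_add_distrib, ← Finset.mul_sum, ← Finset.mul_sum, hsum, hsum, hA, hB]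
          norm_num
  nlinarith [sq_nonneg ‖A - B‖]

open Classical in
/-- There is a small set of low-rank states whose outcome distributions approximate those of all
low-rank states, for every measurement. -/
theorem exists_state_net (d r : ℕ) {γ : ℝ} (hγ0 : 0 < γ) (hγ1 : γ ≤ 1) :
    ∃ N : Finset (QState d), (∀ σ ∈ N, σ.mat.rank ≤ r) ∧
      (N.card : ℝ) ≤ (6 / γ) ^ (2 * (d * r)) ∧
      ∀ ρ : QState d, ρ.mat.rank ≤ r → ∃ σ ∈ N,
        ∀ (X : Type) [Fintype X] (M : POVM d X), ∑ x, |M.prob ρ x - M.prob σ x| ≤ γ := by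
  -- Radius `γ / 2` offsets the Lipschitz constant 2 of `POVM.sum_abs_prob_sub_le`.
  obtain ⟨N, hN1, hNc, hN⟩ := exists_finite_net
    {A : Matrix (Fin d) (Fin r) ℂ | ‖A‖ = 1} (fun A hA => le_of_eq hA)
    (half_pos hγ0) (by linarith)
  have hfr : Module.finrank ℝ (Matrix (Fin d) (Fin r) ℂ) = 2 * (d * r) := by
    rw [Module.finrank_matrix, Complex.finrank_real_complex]
    simp
    ring
  rw [hfr, show 3 / (γ / 2) = 6 / γ by field_simp; norm_num] at hNc
  refine ⟨N.attach.image fun A => QState.ofFactor A.1 (hN1 A.2), ?_, ?_, ?_⟩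
  · intro σ hσ
    obtain ⟨A, -, rfl⟩ := Finset.mem_image.1 hσ
    exact QState.rank_ofFactor_le _ _
  · refine le_trans ?_ hNc
    exact_mod_cast Finset.card_image_le.trans (Finset.card_attach).le
  · intro ρ hρ
    obtain ⟨A, hA, rfl⟩ := ρ.exists_eq_ofFactor hρ
    obtain ⟨B, hB, hAB⟩ := hN A hA
    refine ⟨_, Finset.mem_image.2 ⟨⟨B, hB⟩, Finset.mem_attach _ _, rfl⟩, fun X _ M => ?_⟩
    refine (M.sum_abs_prob_sub_le A B hA (hN1 hB)).trans ?_
    linarith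

end StateNet

/-! ### A measurement that does not contract the Frobenius distance of states -/

section Measurement

open Matrix
open scoped Matrix.Norms.Frobenius

lemma sum_signVal_mul_signVal {ι : Type*} [Fintype ι] [DecidableEq ι] (a b : ι) :
    ∑ η : ι → ℤˣ, signVal (η a) * signVal (η b) =
      if a = b then (Fintype.card (ι → ℤˣ) : ℝ) else 0 := by
  split_ifs with h
  · subst h
    simp [signVal_mul_self]
  · rw [← Fintype.card_mul_expect, expect_signVal_mul_eq_zero (F := fun η => signVal (η b)),
      mul_zero]
    intro η
    simp [Function.update_of_ne (Ne.symm h)]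

variable {d : ℕ}

/-- The vector with entries `±1 ± i` given by a family of signs. -/
noncomputable def signVec (η : Fin d ⊕ Fin d → ℤˣ) (j : Fin d) : ℂ :=
  ⟨signVal (η (Sum.inl j)), signVal (η (Sum.inr j))⟩

lemma sum_signVec_mul_star (i j : Fin d) :
    ∑ η, signVec η i * star (signVec η j) =
      ((if i = j then 2 * Fintype.card (Fin d ⊕ Fin d → ℤˣ) else 0 : ℝ) : ℂ) := by
  apply Complex.ext
  · simp only [signVec, Complex.re_sum, Complex.star_def, Complex.mul_re, Complex.conj_re,
      Complex.conj_im, mul_neg, sub_neg_eq_add, Finset.sum_add_distrib, sum_signVal_mul_signVal,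
      Sum.inl.injEq, Sum.inr.injEq, Complex.ofReal_re]
    split_ifs <;> ring
  · simp only [signVec, Complex.im_sum, Complex.star_def, Complex.mul_im, Complex.conj_re,
      Complex.conj_im, mul_neg, Finset.sum_add_distrib, Finset.sum_neg_distrib,
      sum_signVal_mul_signVal, reduceCtorEq, if_false, Complex.ofReal_im]
    simp

/-- The computational basis measurement and the measurement along all the vectors `signVec η`,
with probability one half each. -/
noncomputable def mixedPOVM (d : ℕ) : POVM d (Fin d ⊕ (Fin d ⊕ Fin d → ℤˣ)) where
  -- The projectors onto sign vectors average to `2 • 1`, hence the 4 for total weight one half.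
  effect := Sum.elim (fun i => (1 / 2 : ℝ) • single i i 1) fun η =>
    (1 / (4 * Fintype.card (Fin d ⊕ Fin d → ℤˣ)) : ℝ) • vecMulVec (signVec η) (star (signVec η))
  posSemidef := by
    rintro (i | η)
    · refine PosSemidef.smul ?_ (by norm_num)
      have h : single i i (1 : ℂ) = vecMulVec (Pi.single i 1) (star (Pi.single i 1)) := by
        simp [single_eq_single_vecMulVec_single]
      rw [h]
      exact posSemidef_vecMulVec_self_star _
    · exact PosSemidef.smul (posSemidef_vecMulVec_self_star _) (by positivity)
  sum_eq_one := by
    have hc : (Fintype.card (Fin d ⊕ Fin d → ℤˣ) : ℂ) ≠ 0 := by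
      exact_mod_cast Fintype.card_ne_zero
    ext i j
    rw [Fintype.sum_sum_type]
    simp only [Sum.elim_inl, Sum.elim_inr, ← Finset.smul_sum, Matrix.add_apply, Matrix.smul_apply,
      Matrix.sum_apply,
      vecMulVec_apply, Pi.star_apply, sum_signVec_mul_star, single_apply, one_apply,
      Complex.real_smul]
    by_cases h : i = j
    · subst h
      simp
      field_simp
      norm_num
    · have : ∀ x, ¬(x = i ∧ x = j) := fun x hx => h (hx.1.symm.trans hx.2)
      simp [h, this]

/-- The off-diagonal part of the real quadratic form in the signs `η` given by
`⟨signVec η, X (signVec η)⟩`. -/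
def chaosCoeff (X : Matrix (Fin d) (Fin d) ℂ) (a b : Fin d ⊕ Fin d) : ℝ :=
  if a = b then 0 else
    match a, b with
    | Sum.inl i, Sum.inl j => (X i j).re
    | Sum.inr i, Sum.inr j => (X i j).re
    | Sum.inl i, Sum.inr j => -(X i j).im
    | Sum.inr i, Sum.inl j => (X i j).im

lemma chaosCoeff_symm {X : Matrix (Fin d) (Fin d) ℂ} (hX : X.IsHermitian) (a b : Fin d ⊕ Fin d) :
    chaosCoeff X a b = chaosCoeff X b a := by
  have hre : ∀ i j, (X i j).re = (X j i).re := fun i j => by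
    rw [← hX.apply i j, Complex.star_def, Complex.conj_re]
  have him : ∀ i j, -(X i j).im = (X j i).im := fun i j => by
    rw [← hX.apply j i, Complex.star_def, Complex.conj_im]
  unfold chaosCoeff
  by_cases h : a = b
  · simp [h]
  rw [if_neg h, if_neg (Ne.symm h)]
  rcases a with i | i <;> rcases b with j | j
  · exact hre i j
  · exact him i j
  · exact (him j i).symm
  · exact hre i j

/-- Every entry of a sign vector has squared modulus 2, so the diagonal contributes twice the trace,
which is zero. -/
lemma re_trace_mul_vecMulVec {X : Matrix (Fin d) (Fin d) ℂ} (hX : X.IsHermitian)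
    (hX0 : X.trace = 0) (η : Fin d ⊕ Fin d → ℤˣ) :
    (X * vecMulVec (signVec η) (star (signVec η))).trace.re =
      quadChaos (chaosCoeff X) Finset.univ η := by
  have him : ∀ i, (X i i).im = 0 := fun i => by
    have h := congrArg Complex.im (hX.apply i i)
    rw [Complex.star_def, Complex.conj_im] at h
    linarith
  have htr : ∑ i, (X i i).re = 0 := by
    simpa [trace] using congrArg Complex.re hX0
  have hpt : ∀ i j, (X i j * (signVec η j * star (signVec η i))).re =
      chaosCoeff X (.inl i) (.inl j) * (signVal (η (.inl i)) * signVal (η (.inl j))) +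
      chaosCoeff X (.inl i) (.inr j) * (signVal (η (.inl i)) * signVal (η (.inr j))) +
      chaosCoeff X (.inr i) (.inl j) * (signVal (η (.inr i)) * signVal (η (.inl j))) +
      chaosCoeff X (.inr i) (.inr j) * (signVal (η (.inr i)) * signVal (η (.inr j))) +
      if i = j then 2 * (X i i).re else 0 := by
    intro i j
    by_cases h : i = j
    · subst h
      simp only [chaosCoeff, signVec, Complex.star_def, Complex.mul_re, Complex.mul_im,
        Complex.conj_re, Complex.conj_im, him, if_true, reduceCtorEq, if_false]
      linear_combination (X i i).re * signVal_sq (η (.inl i)) +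
        (X i i).re * signVal_sq (η (.inr i))
    · simp only [chaosCoeff, signVec, Complex.star_def, Complex.mul_re, Complex.mul_im,
        Complex.conj_re, Complex.conj_im, Sum.inl.injEq, Sum.inr.injEq, h, reduceCtorEq, if_false]
      ring
  have htrace : (X * vecMulVec (signVec η) (star (signVec η))).trace.re =
      ∑ i, ∑ j, (X i j * (signVec η j * star (signVec η i))).re := by
    simp only [trace, diag_apply, mul_apply, vecMulVec_apply, Pi.star_apply, Complex.re_sum]
  rw [htrace]
  simp only [hpt, Finset.sum_add_distrib, Finset.sum_ite_eq, Finset.mem_univ, if_true,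
    ← Finset.mul_sum, htr, mul_zero, add_zero, quadChaos, Fintype.sum_sum_type]
  ring

/-- The two blocks with first index `inl` already account for the off-diagonal entries; the factor 2
matches `expect_quadChaos_sq`. -/
lemma frobenius_norm_sq_le_chaosCoeff (X : Matrix (Fin d) (Fin d) ℂ) (hX : X.IsHermitian) :
    ‖X‖ ^ 2 ≤ ∑ i, (X i i).re ^ 2 + 2 * ∑ a, ∑ b, chaosCoeff X a b ^ 2 := by
  have him : ∀ i, (X i i).im = 0 := fun i => by
    have h := congrArg Complex.im (hX.apply i i)
    rw [Complex.star_def, Complex.conj_im] at h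
    linarith
  have hpt : ∀ i j, ‖X i j‖ ^ 2 = (if i = j then (X i i).re ^ 2 else 0) +
      (chaosCoeff X (.inl i) (.inl j) ^ 2 + chaosCoeff X (.inl i) (.inr j) ^ 2) := by
    intro i j
    rw [← Complex.normSq_eq_norm_sq, Complex.normSq_apply]
    by_cases h : i = j
    · subst h
      simp [chaosCoeff, him]
      ring
    · simp [chaosCoeff, h]
      ring
  rw [frobenius_norm_sq]
  simp only [hpt, Finset.sum_add_distrib, Finset.sum_ite_eq, Finset.mem_univ, if_true,
    Fintype.sum_sum_type]
  have h1 : 0 ≤ ∑ i, ∑ j, chaosCoeff X (.inl i) (.inl j) ^ 2 := by positivity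
  have h2 : 0 ≤ ∑ i, ∑ j, chaosCoeff X (.inl i) (.inr j) ^ 2 := by positivity
  have h3 : 0 ≤ ∑ i, ∑ j, chaosCoeff X (.inr i) (.inl j) ^ 2 := by positivity
  have h4 : 0 ≤ ∑ i, ∑ j, chaosCoeff X (.inr i) (.inr j) ^ 2 := by positivity
  linarith

lemma POVM.prob_sub_prob {X : Type} [Fintype X] (M : POVM d X) (ρ σ : QState d) (x : X) :
    M.prob ρ x - M.prob σ x = ((ρ.mat - σ.mat) * M.effect x).trace.re := by
  rw [Matrix.sub_mul, trace_sub, Complex.sub_re]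
  rfl

/-- Basis outcomes control the diagonal, sign outcomes the rest: the latter carry weight 1/4 and the
moment comparison costs 24, whence `96 = 4 * 24`. -/
theorem frobenius_norm_sub_le_sum_abs_prob_sub (ρ σ : QState d) :
    ‖ρ.mat - σ.mat‖ ≤ 96 * ∑ x, |(mixedPOVM d).prob ρ x - (mixedPOVM d).prob σ x| := by
  simp only [POVM.prob_sub_prob]
  have hX : (ρ.mat - σ.mat).IsHermitian := ρ.posSemidef.isHermitian.sub σ.posSemidef.isHermitian
  have hX0 : (ρ.mat - σ.mat).trace = 0 := by
    rw [trace_sub, ρ.trace_eq_one, σ.trace_eq_one, sub_self]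
  generalize ρ.mat - σ.mat = X at *
  have hsymm := chaosCoeff_symm hX
  have hdiag : ∀ a, chaosCoeff X a a = 0 := fun a => by simp [chaosCoeff]
  have hinl : ∀ i, |(X * (mixedPOVM d).effect (.inl i)).trace.re| = 1 / 2 * |(X i i).re| := by
    intro i
    simp only [mixedPOVM, Sum.elim_inl, Matrix.mul_smul, trace_smul, Complex.smul_re, smul_eq_mul,
      trace_mul_single, abs_mul]
    norm_num
  have hinr : ∀ η, |(X * (mixedPOVM d).effect (.inr η)).trace.re| =
      1 / 4 * (|quadChaos (chaosCoeff X) Finset.univ η| /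
        Fintype.card (Fin d ⊕ Fin d → ℤˣ)) := by
    intro η
    simp only [mixedPOVM, Sum.elim_inr, Matrix.mul_smul, trace_smul, Complex.smul_re, smul_eq_mul]
    rw [re_trace_mul_vecMulVec hX hX0, abs_mul, abs_of_nonneg (by positivity)]
    field_simp
  rw [Fintype.sum_sum_type]
  simp only [hinl, hinr, ← Finset.mul_sum, ← Finset.sum_div]
  rw [← Fintype.expect_eq_sum_div_card]
  have h1 := sqrt_expect_sq_le_expect_abs_quadChaos hsymm hdiag Finset.univ
  have h2 := frobenius_norm_sq_le_chaosCoeff X hX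
  rw [← expect_quadChaos_sq hsymm hdiag] at h2
  have h3 : √(∑ i, (X i i).re ^ 2) ≤ ∑ i, |(X i i).re| := by
    refine Real.sqrt_le_iff.2 ⟨by positivity, ?_⟩
    simp only [← sq_abs (X _ _).re]
    exact Finset.sum_sq_le_sq_sum_of_nonneg fun i _ => abs_nonneg _
  have h4 : ‖X‖ ≤ √(∑ i, (X i i).re ^ 2) +
      √(𝔼 η, quadChaos (chaosCoeff X) Finset.univ η ^ 2) := by
    rw [← Real.sqrt_sq (norm_nonneg X)]
    refine (Real.sqrt_le_sqrt h2).trans ?_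
    refine Real.sqrt_le_iff.2 ⟨by positivity, ?_⟩
    have ha : 0 ≤ ∑ i, (X i i).re ^ 2 := by positivity
    have hb : 0 ≤ 𝔼 η, quadChaos (chaosCoeff X) Finset.univ η ^ 2 :=
      Finset.expect_nonneg fun η _ => sq_nonneg _
    nlinarith [Real.sq_sqrt ha, Real.sq_sqrt hb, mul_nonneg (Real.sqrt_nonneg
      (∑ i, (X i i).re ^ 2)) (Real.sqrt_nonneg
      (𝔼 η, quadChaos (chaosCoeff X) Finset.univ η ^ 2))]
  have h5 : 0 ≤ ∑ i, |(X i i).re| := by positivity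
  linarith

/-! ### Trace distance and Frobenius distance -/

lemma Matrix.IsHermitian.sum_sq_eigenvalues {X : Matrix (Fin d) (Fin d) ℂ} (hX : X.IsHermitian) :
    ∑ i, hX.eigenvalues i ^ 2 = ‖X‖ ^ 2 := by
  have h := trace_mul_conjTranspose_self X
  rw [hX.eq] at h
  conv_lhs at h => rw [hX.spectral_theorem, ← map_mul, Unitary.conjStarAlgAut_apply,
    trace_mul_cycle, Unitary.coe_star_mul_self, Matrix.one_mul, diagonal_mul_diagonal,
    trace_diagonal]
  have h' := congrArg Complex.re h
  rw [Complex.ofReal_re, Complex.re_sum] at h'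
  rw [← h']
  refine Finset.sum_congr rfl fun i _ => ?_
  simp [sq]

/-- Cauchy–Schwarz against the indicator of the nonzero eigenvalues. -/
lemma Matrix.IsHermitian.sum_abs_eigenvalues_le {X : Matrix (Fin d) (Fin d) ℂ}
    (hX : X.IsHermitian) : ∑ i, |hX.eigenvalues i| ≤ √X.rank * ‖X‖ := by
  have h : (∑ i, |hX.eigenvalues i|) ^ 2 ≤ X.rank * ‖X‖ ^ 2 := by
    calc (∑ i, |hX.eigenvalues i|) ^ 2
        = (∑ i, (if hX.eigenvalues i ≠ 0 then 1 else 0) * |hX.eigenvalues i|) ^ 2 := by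
          congr 1
          refine Finset.sum_congr rfl fun i _ => ?_
          by_cases hi : hX.eigenvalues i = 0 <;> simp [hi]
      _ ≤ _ := Finset.sum_mul_sq_le_sq_mul_sq _ _ _
      _ = X.rank * ‖X‖ ^ 2 := by
          simp only [sq_abs, hX.sum_sq_eigenvalues, ite_pow, one_pow, ne_eq, OfNat.ofNat_ne_zero,
            not_false_eq_true, zero_pow, Finset.sum_boole]
          rw [hX.rank_eq_card_non_zero_eigs, Fintype.card_subtype]
  refine abs_le_of_sq_le_sq' (h.trans ?_) (by positivity) |>.2
  rw [mul_pow, Real.sq_sqrt (by positivity)]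

lemma Matrix.rank_sub_le {m n : Type*} [Fintype m] [Fintype n] (A B : Matrix m n ℂ) :
    (A - B).rank ≤ A.rank + B.rank := by
  have h : (A - B).mulVecLin.range ≤ A.mulVecLin.range ⊔ B.mulVecLin.range := by
    rintro _ ⟨v, rfl⟩
    rw [mulVecLin_apply, sub_mulVec]
    exact Submodule.sub_mem_sup ⟨v, rfl⟩ ⟨v, rfl⟩
  exact (Submodule.finrank_mono h).trans (Submodule.finrank_add_le_finrank_add_finrank _ _)

/-- The difference has rank at most `2r`, and `√(2r) ≤ 2√r` cancels the one half in the trace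
distance. -/
lemma QState.traceDist_le (ρ σ : QState d) {r : ℕ} (hρ : ρ.mat.rank ≤ r) (hσ : σ.mat.rank ≤ r) :
    ρ.traceDist σ ≤ √r * ‖ρ.mat - σ.mat‖ := by
  have h := (ρ.posSemidef.isHermitian.sub σ.posSemidef.isHermitian).sum_abs_eigenvalues_le
  have hr : (ρ.mat - σ.mat).rank ≤ 2 * r := by
    refine (rank_sub_le _ _).trans ?_
    omega
  have hs : √(ρ.mat - σ.mat).rank ≤ 2 * √r := by
    refine Real.sqrt_le_iff.2 ⟨by positivity, ?_⟩
    rw [mul_pow, Real.sq_sqrt (by positivity)]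
    have : ((ρ.mat - σ.mat).rank : ℝ) ≤ 2 * r := by exact_mod_cast hr
    have h0 : (0 : ℝ) ≤ r := by positivity
    linarith
  rw [QState.traceDist]
  nlinarith [mul_le_mul_of_nonneg_right hs (norm_nonneg (ρ.mat - σ.mat))]

/-! ### Outcome probabilities -/

lemma POVM.prob_nonneg {X : Type} [Fintype X] (M : POVM d X) (ρ : QState d) (x : X) :
    0 ≤ M.prob ρ x := by
  obtain ⟨A, hA⟩ := ρ.posSemidef.exists_eq_mul_conjTranspose (rank_le_width _)
  obtain ⟨B, hB⟩ := (M.posSemidef x).exists_eq_mul_conjTranspose (rank_le_width _)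
  have h := re_trace_mul_conjTranspose_mul A Bᴴ
  rw [conjTranspose_conjTranspose, ← hA, ← hB] at h
  rw [POVM.prob, h]
  positivity

lemma POVM.sum_prob {X : Type} [Fintype X] (M : POVM d X) (ρ : QState d) :
    ∑ x, M.prob ρ x = 1 := by
  simp only [POVM.prob]
  rw [← Complex.re_sum, ← trace_sum, ← Finset.mul_sum, M.sum_eq_one, Matrix.mul_one,
    ρ.trace_eq_one, Complex.one_re]

lemma QState.exists_rank_le {d r : ℕ} (hr : 1 ≤ r) (hrd : r ≤ d) :
    ∃ ρ : QState d, ρ.mat.rank ≤ r := by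
  have : Nonempty (Fin d) := ⟨⟨0, by omega⟩⟩
  have : Nonempty (Fin r) := ⟨⟨0, by omega⟩⟩
  obtain ⟨A, hA⟩ := exists_norm_eq (Matrix (Fin d) (Fin r) ℂ) zero_le_one
  exact ⟨_, QState.rank_ofFactor_le A hA⟩

end Measurement

/-! ### Sample size and conclusion -/

/-- The union bound over pairs of net points is affordable with the given number of copies. -/
lemma card_sq_mul_exp_le {d r n : ℕ} (hr : 1 ≤ r) {γ δ N : ℝ} (hγ0 : 0 < γ)
    (hγ1 : γ < 1) (hδ0 : 0 < δ) (hδ1 : δ < 1) (hN0 : 0 ≤ N) (hN : N ≤ (6 / γ) ^ (2 * (d * r)))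
    (hn : 48 * ((d * r * Real.log (2 * r / γ) + Real.log (1 / δ)) / γ ^ 2) ≤ n) :
    N ^ 2 * Real.exp (-(n * γ ^ 2 / 4)) ≤ δ := by
  have hr' : (1 : ℝ) ≤ r := by exact_mod_cast hr
  -- The union bound costs `4 d r log(6/γ) ≤ 12 d r log(2r/γ)` in the exponent; Chernoff's `n γ² /
  -- 4` pays for it when the constant is `48 = 4 * 12`.
  have hlog : Real.log (6 / γ) ≤ 3 * Real.log (2 * r / γ) := by
    rw [show (3 : ℝ) = ((3 : ℕ) : ℝ) by norm_num, ← Real.log_pow]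
    refine Real.log_le_log (by positivity) ?_
    calc 6 / γ ≤ (2 / γ) ^ 3 := by
          rw [div_pow, div_le_div_iff₀ hγ0 (by positivity)]
          nlinarith [mul_pos hγ0 hγ0, mul_pos hγ0 (sub_pos.2 hγ1)]
      _ ≤ (2 * r / γ) ^ 3 := by
          gcongr
          linarith
  have hpow : (6 / γ) ^ (2 * (d * r)) = Real.exp (2 * (d * r) * Real.log (6 / γ)) := by
    rw [← Real.exp_log (show 0 < (6 / γ) ^ (2 * (d * r)) by positivity), Real.log_pow]
    push_cast
    rfl
  have hlogδ : 0 ≤ Real.log (1 / δ) := Real.log_nonneg (by rw [le_div_iff₀ hδ0]; linarith)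
  rw [← mul_div_assoc, div_le_iff₀ (by positivity)] at hn
  calc N ^ 2 * Real.exp (-(n * γ ^ 2 / 4))
      ≤ Real.exp (2 * (d * r) * Real.log (6 / γ)) ^ 2 * Real.exp (-(n * γ ^ 2 / 4)) := by
        rw [← hpow]
        gcongr
    _ = Real.exp (4 * (d * r) * Real.log (6 / γ) - n * γ ^ 2 / 4) := by
        rw [← Real.exp_nat_mul, ← Real.exp_add]
        congr 1
        push_cast
        ring
    _ ≤ Real.exp (-Real.log (1 / δ)) := by
        refine Real.exp_le_exp.2 ?_
        have h := mul_le_mul_of_nonneg_left hlog (show (0 : ℝ) ≤ 4 * (d * r) by positivity)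
        linarith
    _ = δ := by rw [one_div, Real.log_inv, neg_neg, Real.exp_log hδ0]

theorem mainTheorem3 :
    ∃ C₁ C₂ : ℝ, 0 < C₁ ∧ 0 < C₂ ∧
      ∀ d r : ℕ, 1 ≤ r → r ≤ d →
        ∀ γ δ : ℝ, 0 < γ → γ < 1 → 0 < δ → δ < 1 →
          ∀ n : ℕ,
            C₂ * ((d * r * Real.log (2 * r / γ) + Real.log (1 / δ)) / γ ^ 2) ≤ n →
              ∃ T : TomographyAlgorithm d n, T.Learns r γ (C₁ * (γ * √r)) δ := by
  -- `864 = 96 * 9`: loss of the measurement times error of the estimator.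
  refine ⟨864, 48, by norm_num, by norm_num, ?_⟩
  intro d r hr hrd γ δ hγ0 hγ1 hδ0 hδ1 n hn
  have hn0 : 0 < n := by
    have hlogδ : 0 < Real.log (1 / δ) := Real.log_pos (by rw [lt_div_iff₀ hδ0]; linarith)
    have hr' : (1 : ℝ) ≤ r := by exact_mod_cast hr
    have hlog : 0 ≤ Real.log (2 * r / γ) :=
      Real.log_nonneg (by rw [le_div_iff₀ hγ0]; linarith)
    have h : (0 : ℝ) < n := lt_of_lt_of_le (by positivity) hn
    exact_mod_cast h
  obtain ⟨N, hNr, hNc, hN⟩ := exists_state_net d r hγ0 hγ1.le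
  have hNne : N.Nonempty := by
    obtain ⟨ρ, hρ⟩ := QState.exists_rank_le hr hrd
    obtain ⟨σ, hσ, -⟩ := hN ρ hρ
    exact ⟨σ, hσ⟩
  obtain ⟨est, hest, hspec⟩ :=
    exists_robust_estimator N hNne (mixedPOVM d).prob hγ0 hγ1.le hn0
  refine ⟨⟨_, fun _ => mixedPOVM d, est⟩, fun ρ hρ A hA => ?_⟩
  obtain ⟨σ, hσ, hρσ⟩ := hN ρ hρ
  obtain ⟨G, hG, hGspec⟩ := hspec _ ((mixedPOVM d).prob_nonneg ρ) ((mixedPOVM d).sum_prob ρ)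
    ⟨σ, hσ, hρσ _ _⟩
  have hδ := card_sq_mul_exp_le hr hγ0 hγ1 hδ0 hδ1 (Nat.cast_nonneg _) hNc hn
  refine (sub_le_sub_left hδ 1).trans (hG.trans ?_)
  refine Finset.sum_le_sum_of_subset_of_nonneg (fun x hx => ?_) fun x _ _ =>
    Finset.prod_nonneg fun i _ => (mixedPOVM d).prob_nonneg ρ _
  refine Finset.mem_filter.2 ⟨Finset.mem_univ _, ?_⟩
  refine ((est (A x)).traceDist_le ρ (hNr _ (hest _)) hρ).trans ?_
  have h1 := frobenius_norm_sub_le_sum_abs_prob_sub (est (A x)) ρ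
  have h2 := hGspec x hx (A x) (hA x)
  calc _ ≤ √r * (96 * (9 * γ)) := by
        gcongr
        linarith
    _ = 864 * (γ * √r) := by ring
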